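/- There is a universal constant $C'>0$ with the following property. Let $E$ be a complete, separable metric space that is geodesic, meaning that every two points of $E$ are joined by a length-minimizing geodesic. All curves $\gamma\colon[0,\ell(\gamma)]\to E$ are parametrized by arc length, where $\ell(\gamma)\ge 0$ is the length (constant curves, of length $0$, are allowed). Such a curve is a geodesic if $d(\gamma(s),\gamma(t))=|s-t|$ for all $s,t$; it is piecewise geodesic if there is a partition $0=s_0<s_1<\dots<s_k=\ell(\gamma)$ such that each $\gamma|_{[s_{i-1},s_i]}$ is a geodesic; and it is closed if $\gamma(\ell(\gamma))=\gamma(0)$. The curve $\gamma$ defines the $1$-current $$[[\gamma]](f,\pi)=\int_0^{\ell(\gamma)} (f\circ\gamma)(t)\,d(\pi\circ\gamma)(t)$$ (a Riemann--Stieltjes integral), acting on all pairs $(f,\pi)$ of Lipschitz functions $f,\pi\colon E\to\mathbb{R}$ with $f$ bounded, and its Morrey norm is $$\|\gamma\|_{\mathrm{Morrey}}=\sup_{x\in E,\ r>0}\frac{\bigl|\{t\in[0,\ell(\gamma)] : d(x,\gamma(t))\le r\}\bigr|}{r},$$ where $|\cdot|$ is Lebesgue measure. Then for every $0<\eta<1$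 and every closed piecewise-geodesic curve $\gamma$ in $E$ there exist an integer $N\ge 1$ and closed piecewise-geodesic curves $\gamma_1,\dots,\gamma_N$ in $E$ such that 1. $[[\gamma]]=\sum_{j=1}^N[[\gamma_j]]$; 2. $\sum_{j=1}^N\ell(\gamma_j)\le(1+\eta)\,\ell(\gamma)$; 3. $\|\gamma_j\|_{\mathrm{Morrey}}\le C'/\eta^2$ for every $j=1,\dots,N$. -/

import Mathlib

universe u

open Set MeasureTheory

open scoped ENNReal NNReal

/-- `HasRSIntegral f g a b I`: the Riemann–Stieltjes integral `∫_a^b f dg` exists and equals `I`,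
i.e. the sums `∑ f (τ i) (g (s (i+1)) - g (s i))` over tagged partitions
`a = s 0 ≤ s 1 ≤ ⋯ ≤ s k = b`, `τ i ∈ [s i, s (i+1)]`, tend to `I` as the mesh tends to `0`. -/
def HasRSIntegral (f g : ℝ → ℝ) (a b I : ℝ) : Prop :=
  ∀ ε > 0, ∃ δ > 0, ∀ (k : ℕ) (s τ : ℕ → ℝ), Monotone s → s 0 = a → s k = b →
    (∀ i < k, τ i ∈ Icc (s i) (s (i + 1))) → (∀ i < k, s (i + 1) - s i < δ) →
    |∑ i ∈ Finset.range k, f (τ i) * (g (s (i + 1)) - g (s i)) - I| < ε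

theorem HasRSIntegral.unique {f g : ℝ → ℝ} {a b I J : ℝ} (hab : a ≤ b)
    (hI : HasRSIntegral f g a b I) (hJ : HasRSIntegral f g a b J) : I = J := by
  by_contra hne
  have hpos : 0 < |I - J| / 2 := by
    have := abs_pos.mpr (sub_ne_zero.mpr hne)
    linarith
  obtain ⟨δ, hδ, h1⟩ := hI _ hpos
  obtain ⟨δ', hδ', h2⟩ := hJ _ hpos
  obtain ⟨n, hn⟩ := exists_nat_gt ((b - a) / min δ δ')
  have hm : 0 < min δ δ' := lt_min hδ hδ'
  have hn0 : (0 : ℝ) < n := lt_of_le_of_lt (div_nonneg (by linarith) hm.le) hn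
  have hstep : (b - a) / n < min δ δ' := by
    rw [div_lt_iff₀ hm] at hn
    rw [div_lt_iff₀ hn0]
    linarith
  have hstep0 : 0 ≤ (b - a) / n := div_nonneg (by linarith) hn0.le
  let s : ℕ → ℝ := fun i => a + i * ((b - a) / n)
  have hs : Monotone s := by
    intro i j hij
    have : (i : ℝ) ≤ j := by exact_mod_cast hij
    have := mul_le_mul_of_nonneg_right this hstep0
    simp only [s]
    linarith
  have hs0 : s 0 = a := by simp [s]
  have hsn : s n = b := by
    simp only [s]
    field_simp
    ring
  have hd : ∀ i, s (i + 1) - s i = (b - a) / n := by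
    intro i
    simp only [s]
    push_cast
    ring
  have e1 := h1 n s s hs hs0 hsn (fun i _ => ⟨le_rfl, hs (Nat.le_succ i)⟩)
    (fun i _ => by rw [hd]; exact hstep.trans_le (min_le_left _ _))
  have e2 := h2 n s s hs hs0 hsn (fun i _ => ⟨le_rfl, hs (Nat.le_succ i)⟩)
    (fun i _ => by rw [hd]; exact hstep.trans_le (min_le_right _ _))
  have := abs_sub_le I (∑ i ∈ Finset.range n, f (s i) * (g (s (i + 1)) - g (s i))) J
  rw [abs_sub_comm I (∑ i ∈ Finset.range n, _)] at this
  linarith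

/-- The Riemann–Stieltjes integral of one Lipschitz function against another one exists. -/
theorem exists_hasRSIntegral {f g : ℝ → ℝ} {a b : ℝ} {K L : ℝ≥0}
    (hab : a ≤ b) (hf : LipschitzOnWith K f (Icc a b)) (hg : LipschitzOnWith L g (Icc a b)) :
    ∃ I, HasRSIntegral f g a b I := by
  have hac : AbsolutelyContinuousOnInterval g a b :=
    LipschitzOnWith.absolutelyContinuousOnInterval (by rwa [uIcc_of_le hab])
  have hint : IntervalIntegrable (deriv g) volume a b := hac.intervalIntegrable_deriv
  have hfc : ContinuousOn f (uIcc a b) := by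
    rw [uIcc_of_le hab]
    exact hf.continuousOn
  have hfg : IntervalIntegrable (fun t => f t * deriv g t) volume a b :=
    hint.continuousOn_mul hfc
  set A : ℝ := ∫ t in a..b, |deriv g t| with hA
  have hA0 : 0 ≤ A := intervalIntegral.integral_nonneg hab fun _ _ => abs_nonneg _
  refine ⟨∫ t in a..b, f t * deriv g t, fun ε hε => ⟨ε / (2 * (K * A + 1)), by positivity, ?_⟩⟩
  intro k s τ hs h0 hk hτ hmesh
  set δ := ε / (2 * ((K : ℝ) * A + 1)) with hδ
  have hsub : ∀ i < k, uIcc (s i) (s (i + 1)) ⊆ uIcc a b := by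
    intro i hi
    rw [uIcc_of_le (hs (Nat.le_succ i)), uIcc_of_le hab, ← h0, ← hk]
    exact Icc_subset_Icc (hs (Nat.zero_le i)) (hs hi)
  have hsum := intervalIntegral.sum_integral_adjacent_intervals (a := s) (n := k)
    fun i hi => hfg.mono_set (hsub i hi)
  have hsumA := intervalIntegral.sum_integral_adjacent_intervals (a := s) (n := k)
    fun i hi => hint.abs.mono_set (hsub i hi)
  rw [h0, hk] at hsum hsumA
  rw [← hsum, ← Finset.sum_sub_distrib]
  have hbound : ∀ i ∈ Finset.range k,
      |f (τ i) * (g (s (i + 1)) - g (s i)) - ∫ t in s i..s (i + 1), f t * deriv g t|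
        ≤ K * δ * ∫ t in s i..s (i + 1), |deriv g t| := by
    intro i hi
    rw [Finset.mem_range] at hi
    have hle := hs (Nat.le_succ i)
    have hint_i := hint.mono_set (hsub i hi)
    rw [← (hac.mono (hsub i hi)).integral_deriv_eq_sub, ← intervalIntegral.integral_const_mul,
      ← intervalIntegral.integral_sub (hint_i.const_mul _) (hfg.mono_set (hsub i hi)),
      ← intervalIntegral.integral_const_mul, ← Real.norm_eq_abs]
    refine intervalIntegral.norm_integral_le_of_norm_le hle (Filter.Eventually.of_forall ?_)
      (hint_i.abs.const_mul _)
    intro t ht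
    have htm : t ∈ Icc (s i) (s (i + 1)) := Ioc_subset_Icc_self ht
    have hsub' := hsub i hi
    rw [uIcc_of_le hle, uIcc_of_le hab] at hsub'
    have h1 := hf.dist_le_mul _ (hsub' (hτ i hi)) _ (hsub' htm)
    have h2 : dist (τ i) t ≤ δ := (Real.dist_le_of_mem_Icc (hτ i hi) htm).trans (hmesh i hi).le
    have h3 : |f (τ i) - f t| ≤ K * δ := h1.trans (by gcongr)
    rw [← sub_mul, norm_mul, Real.norm_eq_abs, Real.norm_eq_abs]
    gcongr
  refine (Finset.abs_sum_le_sum_abs _ _).trans_lt ((Finset.sum_le_sum hbound).trans_lt ?_)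
  rw [← Finset.mul_sum, hsumA, ← hA]
  have h4 : (K : ℝ) * δ * A = ε / 2 * (K * A / (K * A + 1)) := by
    rw [hδ]
    field_simp
  have h5 : (K : ℝ) * A / (K * A + 1) ≤ 1 := by
    rw [div_le_one (by positivity)]
    linarith
  rw [h4]
  nlinarith

/-- A curve `[0, length] → E` parametrized by arc length: the length of its restriction to
`[0, t]` is `t` for every `t ∈ [0, length]`. The values of `toFun` outside `[0, length]` are
irrelevant. The constant curves are those with `length = 0`. -/
structure ArcCurve (E : Type u) [MetricSpace E] where
  length : ℝ
  length_nonneg : 0 ≤ length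
  toFun : ℝ → E
  arcLength : ∀ t ∈ Icc 0 length, eVariationOn toFun (Icc 0 t) = ENNReal.ofReal t

/-- Metric `1`-forms: pairs `(f, π)` of real Lipschitz functions on `E` with `f` bounded. -/
structure MetricOneForm (E : Type u) [MetricSpace E] where
  f : E → ℝ
  π : E → ℝ
  lipschitz_f : ∃ K, LipschitzWith K f
  bounded_f : ∃ M, ∀ x, |f x| ≤ M
  lipschitz_π : ∃ K, LipschitzWith K π

namespace ArcCurve

variable {E : Type u} [MetricSpace E]

theorem lipschitzOnWith (γ : ArcCurve E) : LipschitzOnWith 1 γ.toFun (Icc 0 γ.length) := by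
  have key : ∀ x ∈ Icc 0 γ.length, ∀ y ∈ Icc 0 γ.length, x ≤ y →
      edist (γ.toFun x) (γ.toFun y) ≤ edist x y := by
    intro x hx y hy hxy
    have h := eVariationOn.Icc_add_Icc γ.toFun (s := univ) hx.1 hxy (mem_univ x)
    simp only [univ_inter] at h
    rw [γ.arcLength x hx, γ.arcLength y hy] at h
    have h2 : eVariationOn γ.toFun (Icc x y) = ENNReal.ofReal (y - x) := by
      rw [ENNReal.ofReal_sub _ hx.1, ← h, ENNReal.add_sub_cancel_left ENNReal.ofReal_ne_top]
    have h3 := eVariationOn.edist_le γ.toFun (left_mem_Icc.mpr hxy) (right_mem_Icc.mpr hxy)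
    rw [h2] at h3
    rwa [edist_comm x, edist_dist y, Real.dist_eq, abs_of_nonneg (sub_nonneg.mpr hxy)]
  intro x hx y hy
  rw [ENNReal.coe_one, one_mul]
  rcases le_total x y with h | h
  · exact key x hx y hy h
  · rw [edist_comm, edist_comm x]
    exact key y hy x hx h

theorem exists_current (γ : ArcCurve E) (ω : MetricOneForm E) :
    ∃ I, HasRSIntegral (ω.f ∘ γ.toFun) (ω.π ∘ γ.toFun) 0 γ.length I := by
  obtain ⟨K, hK⟩ := ω.lipschitz_f
  obtain ⟨L, hL⟩ := ω.lipschitz_π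
  exact exists_hasRSIntegral γ.length_nonneg
    ((hK.lipschitzOnWith (s := univ)).comp γ.lipschitzOnWith (mapsTo_univ _ _))
    ((hL.lipschitzOnWith (s := univ)).comp γ.lipschitzOnWith (mapsTo_univ _ _))

/-- The `1`-current `[[γ]]` of a curve: the functional on metric `1`-forms given by the
Riemann–Stieltjes integral `[[γ]](f, π) = ∫_0^{ℓ(γ)} (f ∘ γ) d(π ∘ γ)`. -/
noncomputable def current (γ : ArcCurve E) : MetricOneForm E → ℝ :=
  fun ω => Classical.choose (γ.exists_current ω)

theorem hasRSIntegral_current (γ : ArcCurve E) (ω : MetricOneForm E) :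
    HasRSIntegral (ω.f ∘ γ.toFun) (ω.π ∘ γ.toFun) 0 γ.length (γ.current ω) :=
  Classical.choose_spec (γ.exists_current ω)

/-- The Morrey norm: the supremum over all `x` and `r > 0` of
`|{t ∈ [0, ℓ(γ)] : d(x, γ(t)) ≤ r}| / r`, as an extended nonnegative real. -/
noncomputable def morreyNorm (γ : ArcCurve E) : ℝ≥0∞ :=
  ⨆ (x : E) (r : ℝ) (_ : 0 < r),
    volume {t | t ∈ Icc 0 γ.length ∧ dist x (γ.toFun t) ≤ r} / ENNReal.ofReal r

/-- The restriction of `γ` to `[a, b]` is a (length-minimizing) geodesic. -/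
def IsGeodesicOn (γ : ArcCurve E) (a b : ℝ) : Prop :=
  ∀ s ∈ Icc a b, ∀ t ∈ Icc a b, dist (γ.toFun s) (γ.toFun t) = |s - t|

def IsGeodesic (γ : ArcCurve E) : Prop :=
  γ.IsGeodesicOn 0 γ.length

/-- There is a partition `0 = s 0 < s 1 < ⋯ < s k = ℓ(γ)` such that `γ` restricts to a geodesic
on each `[s i, s (i+1)]`; for a constant curve, `k = 0`. -/
def IsPiecewiseGeodesic (γ : ArcCurve E) : Prop :=
  ∃ (k : ℕ) (s : Fin (k + 1) → ℝ), StrictMono s ∧ s 0 = 0 ∧ s (Fin.last k) = γ.length ∧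
    ∀ i : Fin k, γ.IsGeodesicOn (s i.castSucc) (s i.succ)

def IsClosedCurve (γ : ArcCurve E) : Prop :=
  γ.toFun γ.length = γ.toFun 0

end ArcCurve

/-- Any two points are joined by a length-minimizing geodesic. -/
def IsGeodesicSpace (E : Type u) [MetricSpace E] : Prop :=
  ∀ x y : E, ∃ γ : ArcCurve E, γ.IsGeodesic ∧ γ.toFun 0 = x ∧ γ.toFun γ.length = y

/-! Cut `γ` into `n` geodesic edges of length at most `δ`, with `n * δ ≤ 2 * ℓ(γ)`, and put `ε = η /
8`. A run of at least four consecutive edges is a shortcut (`IsShortcut`) if its ends are closer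
than `ε * δ` times its number of edges; a closed path with at least four edges is itself one. Take a
shortcut `B` with the fewest edges, join its ends by a geodesic `c`, split off the loop made of `B`
and the reverse of `c`, and let `c`, cut into edges, replace `B` in the path. The two copies of `c`
cancel in the sum of currents, and the path has fewer edges, so induction applies
(`exists_decomposition`).

Morrey bound: no proper part of `B` is a shortcut, so the edges between the first and the last visit
to a ball of radius `r` are either at most three, or so few that `ε * δ` times their number is at
most `2 * (r + δ)`. Each edge spends time at most `min (2 * r) δ` in the ball, so `B` spends `O(r /
ε)` there (`sum_occupation_le_of_no_shortcut`); `c` adds at most `2 * r`.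

Length bound: a loop costs twice the length of `c`, less than `2 * ε * δ * |B|`, while at least `|B|
/ 2` edges disappear. A budget of `4 * ε * δ` per edge pays for this, in total `4 * ε * δ * n ≤ η *
ℓ(γ)`. -/

/-! ### Currents as Lebesgue integrals. -/

/-- The Riemann–Stieltjes integral of one Lipschitz function `f` against another one `g` is the
Lebesgue integral of `f * g'`. -/
theorem hasRSIntegral_integral_mul_deriv {f g : ℝ → ℝ} {a b : ℝ} {K L : ℝ≥0}
    (hab : a ≤ b) (hf : LipschitzOnWith K f (Icc a b)) (hg : LipschitzOnWith L g (Icc a b)) :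
    HasRSIntegral f g a b (∫ t in a..b, f t * deriv g t) := by
  have hac : AbsolutelyContinuousOnInterval g a b :=
    LipschitzOnWith.absolutelyContinuousOnInterval (by rwa [uIcc_of_le hab])
  have hint : IntervalIntegrable (deriv g) volume a b := hac.intervalIntegrable_deriv
  have hfc : ContinuousOn f (uIcc a b) := by
    rw [uIcc_of_le hab]
    exact hf.continuousOn
  have hfg : IntervalIntegrable (fun t => f t * deriv g t) volume a b :=
    hint.continuousOn_mul hfc
  set A : ℝ := ∫ t in a..b, |deriv g t| with hA
  have hA0 : 0 ≤ A := intervalIntegral.integral_nonneg hab fun _ _ => abs_nonneg _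
  -- The error is at most `K * A` times the mesh; the `+ 1` keeps the denominator positive when `K *
  -- A = 0`.
  refine fun ε hε => ⟨ε / (2 * (K * A + 1)), by positivity, ?_⟩
  intro k s τ hs h0 hk hτ hmesh
  set δ := ε / (2 * ((K : ℝ) * A + 1)) with hδ
  have hsub : ∀ i < k, uIcc (s i) (s (i + 1)) ⊆ uIcc a b := by
    intro i hi
    rw [uIcc_of_le (hs (Nat.le_succ i)), uIcc_of_le hab, ← h0, ← hk]
    exact Icc_subset_Icc (hs (Nat.zero_le i)) (hs hi)
  have hsum := intervalIntegral.sum_integral_adjacent_intervals (a := s) (n := k)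
    fun i hi => hfg.mono_set (hsub i hi)
  have hsumA := intervalIntegral.sum_integral_adjacent_intervals (a := s) (n := k)
    fun i hi => hint.abs.mono_set (hsub i hi)
  rw [h0, hk] at hsum hsumA
  rw [← hsum, ← Finset.sum_sub_distrib]
  have hbound : ∀ i ∈ Finset.range k,
      |f (τ i) * (g (s (i + 1)) - g (s i)) - ∫ t in s i..s (i + 1), f t * deriv g t|
        ≤ K * δ * ∫ t in s i..s (i + 1), |deriv g t| := by
    intro i hi
    rw [Finset.mem_range] at hi
    have hle := hs (Nat.le_succ i)
    have hint_i := hint.mono_set (hsub i hi)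
    rw [← (hac.mono (hsub i hi)).integral_deriv_eq_sub, ← intervalIntegral.integral_const_mul,
      ← intervalIntegral.integral_sub (hint_i.const_mul _) (hfg.mono_set (hsub i hi)),
      ← intervalIntegral.integral_const_mul, ← Real.norm_eq_abs]
    refine intervalIntegral.norm_integral_le_of_norm_le hle (Filter.Eventually.of_forall ?_)
      (hint_i.abs.const_mul _)
    intro t ht
    have htm : t ∈ Icc (s i) (s (i + 1)) := Ioc_subset_Icc_self ht
    have hsub' := hsub i hi
    rw [uIcc_of_le hle, uIcc_of_le hab] at hsub'
    have h1 := hf.dist_le_mul _ (hsub' (hτ i hi)) _ (hsub' htm)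
    have h2 : dist (τ i) t ≤ δ := (Real.dist_le_of_mem_Icc (hτ i hi) htm).trans (hmesh i hi).le
    have h3 : |f (τ i) - f t| ≤ K * δ := h1.trans (by gcongr)
    rw [← sub_mul, norm_mul, Real.norm_eq_abs, Real.norm_eq_abs]
    gcongr
  refine (Finset.abs_sum_le_sum_abs _ _).trans_lt ((Finset.sum_le_sum hbound).trans_lt ?_)
  rw [← Finset.mul_sum, hsumA, ← hA]
  have h4 : (K : ℝ) * δ * A = ε / 2 * (K * A / (K * A + 1)) := by
    rw [hδ]
    field_simp
  have h5 : (K : ℝ) * A / (K * A + 1) ≤ 1 := by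
    rw [div_le_one (by positivity)]
    linarith
  rw [h4]
  nlinarith

namespace ArcCurve

variable {E : Type u} [MetricSpace E]

/-- The density `(f ∘ γ) * (π ∘ γ)'` of the current of `γ` with respect to arc length. -/
noncomputable def density (c : ℝ → E) (ω : MetricOneForm E) (t : ℝ) : ℝ :=
  ω.f (c t) * deriv (fun u => ω.π (c u)) t

theorem current_eq_integral (γ : ArcCurve E) (ω : MetricOneForm E) :
    γ.current ω = ∫ t in 0..γ.length, density γ.toFun ω t := by
  obtain ⟨K, hK⟩ := ω.lipschitz_f
  obtain ⟨L, hL⟩ := ω.lipschitz_π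
  exact (γ.hasRSIntegral_current ω).unique γ.length_nonneg
    (hasRSIntegral_integral_mul_deriv γ.length_nonneg
      ((hK.lipschitzOnWith (s := univ)).comp γ.lipschitzOnWith (mapsTo_univ _ _))
      ((hL.lipschitzOnWith (s := univ)).comp γ.lipschitzOnWith (mapsTo_univ _ _)))

theorem intervalIntegrable_density (γ : ArcCurve E) (ω : MetricOneForm E) {a b : ℝ}
    (ha : a ∈ Icc 0 γ.length) (hb : b ∈ Icc 0 γ.length) :
    IntervalIntegrable (density γ.toFun ω) volume a b := by
  obtain ⟨K, hK⟩ := ω.lipschitz_f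
  obtain ⟨L, hL⟩ := ω.lipschitz_π
  have hg : LipschitzOnWith (L * 1) (ω.π ∘ γ.toFun) (uIcc 0 γ.length) := by
    rw [uIcc_of_le γ.length_nonneg]
    exact (hL.lipschitzOnWith (s := univ)).comp γ.lipschitzOnWith (mapsTo_univ _ _)
  have hf : ContinuousOn (ω.f ∘ γ.toFun) (uIcc 0 γ.length) := by
    rw [uIcc_of_le γ.length_nonneg]
    exact hK.continuous.comp_continuousOn γ.lipschitzOnWith.continuousOn
  refine (hg.absolutelyContinuousOnInterval.intervalIntegrable_deriv.continuousOn_mul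
    hf).mono_set ?_
  rw [uIcc_of_le γ.length_nonneg]
  exact uIcc_subset_Icc ha hb

theorem density_congr {c c' : ℝ → E} {t : ℝ} (h : c =ᶠ[nhds t] c') (ω : MetricOneForm E) :
    density c ω t = density c' ω t := by
  have hd : deriv (fun u => ω.π (c u)) t = deriv (fun u => ω.π (c' u)) t :=
    Filter.EventuallyEq.deriv_eq (h.fun_comp ω.π)
  rw [density, density, h.eq_of_nhds, hd]

/-- The density at a point depends on the curve near that point, so agreement on the open interval
suffices and the end points are null. This lets concatenated curves be compared piece by piece,
whatever happens at the junction. -/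
theorem integral_density_congr {c c' : ℝ → E} {a b : ℝ} (hab : a ≤ b)
    (h : ∀ t ∈ Ioo a b, c t = c' t) (ω : MetricOneForm E) :
    ∫ t in a..b, density c ω t = ∫ t in a..b, density c' ω t := by
  rw [intervalIntegral.integral_of_le hab, intervalIntegral.integral_of_le hab,
    integral_Ioc_eq_integral_Ioo, integral_Ioc_eq_integral_Ioo]
  refine setIntegral_congr_fun measurableSet_Ioo fun t ht => density_congr ?_ ω
  filter_upwards [isOpen_Ioo.mem_nhds ht] with u hu using h u hu

theorem density_comp_add_const (c : ℝ → E) (a : ℝ) (ω : MetricOneForm E) (t : ℝ) :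
    density (fun u => c (u + a)) ω t = density c ω (t + a) := by
  rw [density, density, deriv_comp_add_const (fun u => ω.π (c u))]

theorem density_comp_const_sub (c : ℝ → E) (a : ℝ) (ω : MetricOneForm E) (t : ℝ) :
    density (fun u => c (a - u)) ω t = -density c ω (a - t) := by
  rw [density, density, deriv_comp_const_sub (fun u => ω.π (c u)), mul_neg]

/-! ### Restriction, reversal and concatenation of curves. -/

theorem eVariationOn_Icc (γ : ArcCurve E) {a b : ℝ} (ha : 0 ≤ a) (hab : a ≤ b)
    (hb : b ≤ γ.length) : eVariationOn γ.toFun (Icc a b) = ENNReal.ofReal (b - a) := by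
  have h := eVariationOn.Icc_add_Icc γ.toFun (s := univ) ha hab (mem_univ a)
  simp only [univ_inter] at h
  rw [γ.arcLength a ⟨ha, hab.trans hb⟩, γ.arcLength b ⟨ha.trans hab, hb⟩] at h
  rw [ENNReal.ofReal_sub _ ha, ← h, ENNReal.add_sub_cancel_left ENNReal.ofReal_ne_top]

/-- The constant curve at `x`. -/
def const (x : E) : ArcCurve E where
  length := 0
  length_nonneg := le_rfl
  toFun _ := x
  arcLength t ht := by
    obtain rfl : t = 0 := le_antisymm ht.2 ht.1
    rw [Icc_self, eVariationOn.subsingleton _ subsingleton_singleton, ENNReal.ofReal_zero]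

/-- The restriction of `γ` to `[a, b]`. -/
def restrict (γ : ArcCurve E) (a b : ℝ) (ha : 0 ≤ a) (hab : a ≤ b) (hb : b ≤ γ.length) :
    ArcCurve E where
  length := b - a
  length_nonneg := sub_nonneg.mpr hab
  toFun t := γ.toFun (t + a)
  arcLength t ht := by
    have h := eVariationOn.comp_eq_of_monotoneOn γ.toFun (t := Icc 0 t) (fun u => u + a)
      fun x _ y _ hxy => by simpa using hxy
    rw [image_add_const_Icc, zero_add,
      γ.eVariationOn_Icc ha (by linarith [ht.1]) (by linarith [ht.2]), add_sub_cancel_right] at h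
    exact h

/-- The curve `γ` run backwards. -/
def reverse (γ : ArcCurve E) : ArcCurve E where
  length := γ.length
  length_nonneg := γ.length_nonneg
  toFun t := γ.toFun (γ.length - t)
  arcLength t ht := by
    have h := eVariationOn.comp_eq_of_antitoneOn γ.toFun (t := Icc 0 t) (fun u => γ.length - u)
      fun x _ y _ hxy => sub_le_sub_left hxy _
    rw [image_const_sub_Icc, sub_zero, γ.eVariationOn_Icc (by linarith [ht.2])
      (by linarith [ht.1]) le_rfl, sub_sub_cancel] at h
    exact h

/-- The concatenation of two curves. -/
noncomputable def append (γ₁ γ₂ : ArcCurve E) (h : γ₁.toFun γ₁.length = γ₂.toFun 0) :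
    ArcCurve E where
  length := γ₁.length + γ₂.length
  length_nonneg := add_nonneg γ₁.length_nonneg γ₂.length_nonneg
  toFun t := if t ≤ γ₁.length then γ₁.toFun t else γ₂.toFun (t - γ₁.length)
  arcLength t ht := by
    have hleft : ∀ u ≤ γ₁.length, EqOn (fun t => if t ≤ γ₁.length then γ₁.toFun t else
        γ₂.toFun (t - γ₁.length)) γ₁.toFun (Icc 0 u) := fun u hu v hv =>
      if_pos (hv.2.trans hu)
    rcases le_total t γ₁.length with htl | htl
    · rw [eVariationOn.eq_of_eqOn (hleft t htl), γ₁.arcLength t ⟨ht.1, htl⟩]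
    · have hright : EqOn (fun t => if t ≤ γ₁.length then γ₁.toFun t else
          γ₂.toFun (t - γ₁.length)) (γ₂.toFun ∘ fun u => u - γ₁.length) (Icc γ₁.length t) := by
        intro v hv
        rcases hv.1.eq_or_lt with rfl | hlt
        · simp [h]
        · simp [not_le.mpr hlt]
      have hadd := eVariationOn.Icc_add_Icc (fun t => if t ≤ γ₁.length then γ₁.toFun t else
        γ₂.toFun (t - γ₁.length)) (s := univ) γ₁.length_nonneg htl (mem_univ _)
      simp only [univ_inter] at hadd
      rw [← hadd, eVariationOn.eq_of_eqOn (hleft _ le_rfl),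
        γ₁.arcLength _ ⟨γ₁.length_nonneg, le_rfl⟩, eVariationOn.eq_of_eqOn hright,
        eVariationOn.comp_eq_of_monotoneOn γ₂.toFun (fun u => u - γ₁.length)
          (fun x _ y _ hxy => by simpa using hxy), image_sub_const_Icc, sub_self,
        γ₂.arcLength _ ⟨by linarith, by linarith [ht.2]⟩,
        ← ENNReal.ofReal_add γ₁.length_nonneg (by linarith), add_sub_cancel]

theorem current_const (x : E) : (const x).current = 0 := by
  ext ω
  rw [current_eq_integral]
  exact intervalIntegral.integral_same

theorem current_restrict (γ : ArcCurve E) (a b : ℝ) (ha : 0 ≤ a) (hab : a ≤ b)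
    (hb : b ≤ γ.length) (ω : MetricOneForm E) :
    (γ.restrict a b ha hab hb).current ω = ∫ t in a..b, density γ.toFun ω t := by
  rw [current_eq_integral]
  simp only [restrict, density_comp_add_const]
  rw [intervalIntegral.integral_comp_add_right (density γ.toFun ω), zero_add, sub_add_cancel]

theorem current_reverse (γ : ArcCurve E) : γ.reverse.current = -γ.current := by
  ext ω
  rw [Pi.neg_apply, current_eq_integral, current_eq_integral]
  simp only [reverse, density_comp_const_sub]
  rw [intervalIntegral.integral_neg, intervalIntegral.integral_comp_sub_left (density γ.toFun ω),
    sub_self, sub_zero]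

theorem append_toFun_add (γ₁ γ₂ : ArcCurve E) (h : γ₁.toFun γ₁.length = γ₂.toFun 0) {t : ℝ}
    (ht : 0 ≤ t) : (append γ₁ γ₂ h).toFun (t + γ₁.length) = γ₂.toFun t := by
  rcases ht.eq_or_lt with rfl | hlt
  · simp [append, h]
  · simp [append, hlt]

theorem append_toFun_of_le (γ₁ γ₂ : ArcCurve E) (h : γ₁.toFun γ₁.length = γ₂.toFun 0) {t : ℝ}
    (ht : t ≤ γ₁.length) : (append γ₁ γ₂ h).toFun t = γ₁.toFun t :=
  if_pos ht

theorem current_append (γ₁ γ₂ : ArcCurve E) (h : γ₁.toFun γ₁.length = γ₂.toFun 0) :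
    (append γ₁ γ₂ h).current = γ₁.current + γ₂.current := by
  ext ω
  have h₁ := γ₁.length_nonneg
  have h₂ := γ₂.length_nonneg
  have hmid : γ₁.length ∈ Icc 0 (append γ₁ γ₂ h).length :=
    ⟨h₁, le_add_of_nonneg_right h₂⟩
  rw [Pi.add_apply, current_eq_integral,
    ← intervalIntegral.integral_add_adjacent_intervals
      (intervalIntegrable_density _ ω ⟨le_rfl, length_nonneg _⟩ hmid)
      (intervalIntegrable_density _ ω hmid ⟨length_nonneg _, le_rfl⟩),
    current_eq_integral γ₁, current_eq_integral γ₂]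
  congr 1
  · exact integral_density_congr h₁ (fun t ht => append_toFun_of_le _ _ h ht.2.le) ω
  · rw [← integral_density_congr (c := fun t => (append γ₁ γ₂ h).toFun (t + γ₁.length)) h₂
      (fun t ht => append_toFun_add _ _ h ht.1.le) ω]
    simp only [density_comp_add_const]
    rw [intervalIntegral.integral_comp_add_right (density (append γ₁ γ₂ h).toFun ω), zero_add,
      add_comm]
    rfl

theorem IsGeodesicOn.isGeodesic_restrict {γ : ArcCurve E} {a b a' b' : ℝ}
    (hγ : γ.IsGeodesicOn a' b') (ha : 0 ≤ a) (hab : a ≤ b) (hb : b ≤ γ.length)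
    (ha' : a' ≤ a) (hb' : b ≤ b') : (γ.restrict a b ha hab hb).IsGeodesic := by
  intro s hs t ht
  simp only [restrict] at hs ht ⊢
  rw [hγ _ ⟨by linarith [hs.1], by linarith [hs.2]⟩ _ ⟨by linarith [ht.1], by linarith [ht.2]⟩,
    add_sub_add_right_eq_sub]

theorem IsGeodesic.reverse {γ : ArcCurve E} (hγ : γ.IsGeodesic) : γ.reverse.IsGeodesic := by
  intro s hs t ht
  simp only [ArcCurve.reverse] at hs ht ⊢
  rw [hγ _ ⟨by linarith [hs.2], by linarith [hs.1]⟩ _ ⟨by linarith [ht.2], by linarith [ht.1]⟩,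
    sub_sub_sub_cancel_left, abs_sub_comm]

theorem isPiecewiseGeodesic_const (x : E) : (const x).IsPiecewiseGeodesic :=
  ⟨0, fun _ => 0, fun i j hij => by omega, rfl, rfl, fun i => i.elim0⟩

theorem IsPiecewiseGeodesic.append {γ₁ γ₂ : ArcCurve E} (h₁ : γ₁.IsGeodesic)
    (h₂ : γ₂.IsPiecewiseGeodesic) (h : γ₁.toFun γ₁.length = γ₂.toFun 0) :
    (append γ₁ γ₂ h).IsPiecewiseGeodesic := by
  obtain ⟨k, s, hs, h0, hk, hgeo⟩ := h₂
  have hs0 : ∀ i, 0 ≤ s i := fun i => h0 ▸ hs.monotone (Fin.zero_le i)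
  have hshift : ∀ i : Fin k, (ArcCurve.append γ₁ γ₂ h).IsGeodesicOn
      (s i.castSucc + γ₁.length) (s i.succ + γ₁.length) := by
    intro i u hu v hv
    have := hs0 i.castSucc
    rw [← sub_add_cancel u γ₁.length, ← sub_add_cancel v γ₁.length,
      append_toFun_add _ _ h (by linarith [hu.1]), append_toFun_add _ _ h (by linarith [hv.1]),
      hgeo i _ ⟨by linarith [hu.1], by linarith [hu.2]⟩ _ ⟨by linarith [hv.1], by linarith [hv.2]⟩,
      add_sub_add_right_eq_sub]
  -- A constant first curve must not contribute a partition point, since the partition is strictly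
  -- increasing.
  rcases γ₁.length_nonneg.eq_or_lt with hl | hl
  · refine ⟨k, s, hs, h0, ?_, ?_⟩
    · rw [hk]
      simp [ArcCurve.append, ← hl]
    · simpa only [← hl, add_zero] using hshift
  · refine ⟨k + 1, Fin.cons 0 fun i => s i + γ₁.length, ?_, rfl, ?_, ?_⟩
    · refine Fin.strictMono_iff_lt_succ.mpr fun i => ?_
      refine Fin.cases ?_ (fun j => ?_) i
      · simpa [h0] using hl
      · rw [← Fin.succ_castSucc, Fin.cons_succ, Fin.cons_succ]
        have := hs j.castSucc_lt_succ
        linarith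
    · rw [← Fin.succ_last, Fin.cons_succ, hk, add_comm]
      rfl
    · refine Fin.cases ?_ fun j => ?_
      · intro u hu v hv
        simp only [Fin.castSucc_zero, Fin.cons_zero, Fin.cons_succ, h0, zero_add] at hu hv
        rw [append_toFun_of_le _ _ h hu.2, append_toFun_of_le _ _ h hv.2, h₁ u hu v hv]
      · rw [← Fin.succ_castSucc, Fin.cons_succ, Fin.cons_succ]
        exact hshift j

/-! ### Time spent in balls. -/

/-- The time that `γ` spends in the closed ball of radius `r` around `x`. -/
noncomputable def occupation (γ : ArcCurve E) (x : E) (r : ℝ) : ℝ≥0∞ :=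
  volume {t | t ∈ Icc 0 γ.length ∧ dist x (γ.toFun t) ≤ r}

theorem morreyNorm_le {γ : ArcCurve E} {c : ℝ}
    (h : ∀ x r, 0 < r → γ.occupation x r ≤ ENNReal.ofReal (c * r)) :
    γ.morreyNorm ≤ ENNReal.ofReal c := by
  refine iSup_le fun x => iSup_le fun r => iSup_le fun hr => ?_
  refine ENNReal.div_le_of_le_mul ?_
  rw [← ENNReal.ofReal_mul' hr.le]
  exact h x r hr

theorem occupation_le_length (γ : ArcCurve E) (x : E) (r : ℝ) :
    γ.occupation x r ≤ ENNReal.ofReal γ.length := by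
  refine (measure_mono fun t ht => ht.1).trans_eq ?_
  rw [Real.volume_Icc, sub_zero]

/-- A geodesic is an isometric embedding of its interval, so the times spent in a ball of radius `r`
form a set of diameter at most `2 * r`. -/
theorem IsGeodesic.occupation_le {γ : ArcCurve E} (hγ : γ.IsGeodesic) (x : E) (r : ℝ) :
    γ.occupation x r ≤ ENNReal.ofReal (2 * r) := by
  refine (Real.volume_le_diam _).trans (Metric.ediam_le fun s hs t ht => ?_)
  rw [edist_dist, Real.dist_eq, ← hγ s hs.1 t ht.1]
  refine ENNReal.ofReal_le_ofReal ((dist_triangle_left _ _ x).trans ?_)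
  linarith [hs.2, ht.2]

theorem occupation_eq_zero {γ : ArcCurve E} {x : E} {r : ℝ}
    (h : ∀ t ∈ Icc 0 γ.length, r < dist x (γ.toFun t)) : γ.occupation x r = 0 := by
  rw [occupation, show {t | t ∈ Icc 0 γ.length ∧ dist x (γ.toFun t) ≤ r} = ∅ from
    eq_empty_of_forall_notMem fun t ht => (h t ht.1).not_ge ht.2, measure_empty]

theorem occupation_append_le (γ₁ γ₂ : ArcCurve E) (h : γ₁.toFun γ₁.length = γ₂.toFun 0) (x : E)
    (r : ℝ) : (append γ₁ γ₂ h).occupation x r ≤ γ₁.occupation x r + γ₂.occupation x r := by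
  have hpre : γ₂.occupation x r = volume ((fun t => t - γ₁.length) ⁻¹'
      {t | t ∈ Icc 0 γ₂.length ∧ dist x (γ₂.toFun t) ≤ r}) := by
    simp only [sub_eq_add_neg]
    rw [measure_preimage_add_right, occupation]
  rw [hpre]
  refine (measure_mono ?_).trans (measure_union_le _ _)
  rintro t ⟨ht, hd⟩
  rcases le_or_gt t γ₁.length with htl | htl
  · rw [append_toFun_of_le _ _ h htl] at hd
    exact Or.inl ⟨⟨ht.1, htl⟩, hd⟩
  · rw [← sub_add_cancel t γ₁.length, append_toFun_add _ _ h (by linarith)] at hd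
    have hle : t ≤ γ₁.length + γ₂.length := ht.2
    exact Or.inr ⟨⟨by linarith, by linarith⟩, hd⟩

end ArcCurve

/-! ### Paths of geodesic edges and subdivision into short edges. -/

namespace ArcCurve

variable {E : Type u} [MetricSpace E]

/-- The curves of the list `L`, run through one after the other, lead from `x` to `y`. -/
def IsPath : E → E → List (ArcCurve E) → Prop
  | x, y, [] => x = y
  | x, y, e :: L => e.toFun 0 = x ∧ IsPath (e.toFun e.length) y L

theorem isPath_append {x y : E} {A B : List (ArcCurve E)} :
    IsPath x y (A ++ B) ↔ ∃ z, IsPath x z A ∧ IsPath z y B := by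
  induction A generalizing x with
  | nil => simp [IsPath]
  | cons e A ih => simp [IsPath, ih, and_assoc]

theorem isPath_singleton {x y : E} {e : ArcCurve E} :
    IsPath x y [e] ↔ e.toFun 0 = x ∧ e.toFun e.length = y :=
  Iff.rfl

/-- `IsShortcut` hides the end points behind an existential; this identifies them with those at
which the run is cut out of a longer path. The empty path must be excluded, as it joins every point
to itself. -/
theorem isPath_endpoints_unique {x y x' y' : E} {L : List (ArcCurve E)} (hL : L ≠ [])
    (h : IsPath x y L) (h' : IsPath x' y' L) : x = x' ∧ y = y' := by
  induction L generalizing x x' with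
  | nil => exact absurd rfl hL
  | cons e L ih =>
    refine ⟨h.1.symm.trans h'.1, ?_⟩
    rcases eq_or_ne L [] with rfl | hne
    · exact h.2.symm.trans h'.2
    · exact (ih hne h.2 h'.2).2

/-- A path of geodesic edges can be concatenated to a piecewise geodesic curve. -/
theorem exists_curve_of_isPath {x y : E} {L : List (ArcCurve E)} (hL : ∀ e ∈ L, e.IsGeodesic)
    (hp : IsPath x y L) :
    ∃ γ : ArcCurve E, γ.toFun 0 = x ∧ γ.toFun γ.length = y ∧ γ.IsPiecewiseGeodesic ∧
      γ.length = (L.map length).sum ∧ γ.current = (L.map current).sum ∧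
      ∀ z r, γ.occupation z r ≤ (L.map fun e => e.occupation z r).sum := by
  induction L generalizing x with
  | nil =>
    refine ⟨const x, rfl, hp, isPiecewiseGeodesic_const x, rfl, current_const x, fun z r => ?_⟩
    exact (occupation_le_length _ _ _).trans_eq ENNReal.ofReal_zero
  | cons e L ih =>
    obtain ⟨γ, h0, h1, hpg, hlen, hcur, hocc⟩ := ih (fun f hf => hL f (.tail _ hf)) hp.2
    refine ⟨append e γ h0.symm, ?_, ?_, .append (hL e (.head _)) hpg _, ?_, ?_, fun z r => ?_⟩
    · rw [append_toFun_of_le _ _ _ e.length_nonneg, hp.1]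
    · rw [← h1, ← append_toFun_add e γ h0.symm γ.length_nonneg, add_comm]
      rfl
    · rw [List.map_cons, List.sum_cons, ← hlen]
      rfl
    · rw [current_append, hcur, List.map_cons, List.sum_cons]
    · rw [List.map_cons, List.sum_cons]
      exact (occupation_append_le _ _ _ _ _).trans (by gcongr; exact hocc z r)

/-- A geodesic piece of a curve can be divided into `n` edges of length at most `δ` if its length
is at most `n * δ`. -/
theorem IsGeodesicOn.exists_isPath {γ : ArcCurve E} {δ : ℝ} (hδ : 0 ≤ δ) (n : ℕ) {a b : ℝ}
    (hγ : γ.IsGeodesicOn a b) (ha : 0 ≤ a) (hab : a ≤ b) (hb : b ≤ γ.length)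
    (hn : b - a ≤ n * δ) :
    ∃ L : List (ArcCurve E), IsPath (γ.toFun a) (γ.toFun b) L ∧
      (∀ e ∈ L, e.IsGeodesic ∧ e.length ≤ δ) ∧ L.length = n ∧ (L.map length).sum = b - a ∧
      ∀ ω, (L.map current).sum ω = ∫ t in a..b, density γ.toFun ω t := by
  induction n generalizing a with
  | zero =>
    obtain rfl : a = b := le_antisymm hab (by simpa using hn)
    exact ⟨[], rfl, by simp, rfl, by simp, by simp⟩
  | succ n ih =>
    -- The first edge has length `δ` unless `b` comes earlier; once `b` is reached, the remaining
    -- edges are constant.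
    have hac : a ≤ min (a + δ) b := le_min (by linarith) hab
    have hcb : min (a + δ) b ≤ b := min_le_right _ _
    have hca : min (a + δ) b ≤ a + δ := min_le_left _ _
    generalize hc : min (a + δ) b = c at hac hcb hca
    have hcn : b - c ≤ n * δ := by
      push_cast at hn
      rcases min_choice (a + δ) b with h | h
      · linarith
      · have := mul_nonneg (Nat.cast_nonneg' n : (0 : ℝ) ≤ n) hδ
        linarith
    obtain ⟨L, hp, hL, hlen, hsum, hcur⟩ :=
      ih (a := c) (fun s hs t ht => hγ s ⟨hac.trans hs.1, hs.2⟩ t ⟨hac.trans ht.1, ht.2⟩)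
        (ha.trans hac) hcb hcn
    refine ⟨γ.restrict a c ha hac (hcb.trans hb) :: L, ⟨?_, ?_⟩, ?_, ?_, ?_, fun ω => ?_⟩
    · simp [restrict]
    · simpa [restrict] using hp
    · refine List.forall_mem_cons.mpr ⟨⟨hγ.isGeodesic_restrict _ _ _ le_rfl hcb, ?_⟩, hL⟩
      simp only [restrict]
      linarith
    · rw [List.length_cons, hlen]
    · rw [List.map_cons, List.sum_cons, hsum]
      simp only [restrict]
      ring
    · rw [List.map_cons, List.sum_cons, Pi.add_apply, hcur, current_restrict]
      exact intervalIntegral.integral_add_adjacent_intervals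
        (γ.intervalIntegrable_density ω ⟨ha, by linarith⟩ ⟨by linarith, by linarith⟩)
        (γ.intervalIntegrable_density ω ⟨by linarith, by linarith⟩ ⟨by linarith, hb⟩)

/-- Rounding the number of edges up costs at most one extra edge, hence the additional `δ`. -/
theorem IsGeodesicOn.exists_short_isPath {γ : ArcCurve E} {δ : ℝ} (hδ : 0 < δ) {a b : ℝ}
    (hγ : γ.IsGeodesicOn a b) (ha : 0 ≤ a) (hab : a ≤ b) (hb : b ≤ γ.length) :
    ∃ L : List (ArcCurve E), IsPath (γ.toFun a) (γ.toFun b) L ∧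
      (∀ e ∈ L, e.IsGeodesic ∧ e.length ≤ δ) ∧ L.length * δ ≤ (b - a) + δ ∧
      (L.map length).sum = b - a ∧
      ∀ ω, (L.map current).sum ω = ∫ t in a..b, density γ.toFun ω t := by
  have h0 : 0 ≤ (b - a) / δ := div_nonneg (by linarith) hδ.le
  obtain ⟨L, hp, hL, hlen, hsum⟩ := hγ.exists_isPath hδ.le ⌈(b - a) / δ⌉₊ ha hab hb
    ((div_le_iff₀ hδ).mp (Nat.le_ceil _))
  refine ⟨L, hp, hL, ?_, hsum⟩
  have := mul_le_mul_of_nonneg_right (Nat.ceil_lt_add_one h0).le hδ.le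
  rwa [add_mul, one_mul, div_mul_cancel₀ _ hδ.ne', ← hlen] at this

/-- The rounding loss of one `δ` occurs once per geodesic piece, hence the term `i * δ`. -/
theorem exists_short_isPath {γ : ArcCurve E} {δ : ℝ} (hδ : 0 < δ) {k : ℕ} {s : Fin (k + 1) → ℝ}
    (hs : StrictMono s) (h0 : s 0 = 0) (hk : s (Fin.last k) = γ.length)
    (hgeo : ∀ i : Fin k, γ.IsGeodesicOn (s i.castSucc) (s i.succ)) (i : Fin (k + 1)) :
    ∃ L : List (ArcCurve E), IsPath (γ.toFun 0) (γ.toFun (s i)) L ∧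
      (∀ e ∈ L, e.IsGeodesic ∧ e.length ≤ δ) ∧ L.length * δ ≤ s i + (i : ℕ) * δ ∧
      (L.map length).sum = s i ∧
      ∀ ω, (L.map current).sum ω = ∫ t in 0..s i, density γ.toFun ω t := by
  have hs0 : ∀ i, 0 ≤ s i := fun i => h0 ▸ hs.monotone (Fin.zero_le i)
  have hsl : ∀ i, s i ≤ γ.length := fun i => hk ▸ hs.monotone (Fin.le_last i)
  induction i using Fin.induction with
  | zero => exact ⟨[], by rw [h0]; rfl, by simp, by simp [h0], by simp [h0], by simp [h0]⟩
  | succ i ih =>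
    obtain ⟨L, hp, hL, hlen, hsum, hcur⟩ := ih
    obtain ⟨L', hp', hL', hlen', hsum', hcur'⟩ := (hgeo i).exists_short_isPath hδ (hs0 _)
      (hs i.castSucc_lt_succ).le (hsl _)
    refine ⟨L ++ L', isPath_append.mpr ⟨_, hp, hp'⟩, ?_, ?_, ?_, fun ω => ?_⟩
    · exact List.forall_mem_append.mpr ⟨hL, hL'⟩
    · simp only [List.length_append, Fin.val_castSucc, Fin.val_succ] at hlen ⊢
      push_cast
      linarith
    · rw [List.map_append, List.sum_append, hsum, hsum']
      ring
    · rw [List.map_append, List.sum_append, Pi.add_apply, hcur, hcur']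
      exact intervalIntegral.integral_add_adjacent_intervals
        (γ.intervalIntegrable_density ω ⟨le_rfl, γ.length_nonneg⟩ ⟨hs0 _, hsl _⟩)
        (γ.intervalIntegrable_density ω ⟨hs0 _, hsl _⟩ ⟨hs0 _, hsl _⟩)

end ArcCurve

/-! ### Shortcuts and the Morrey bound. -/

/-- If some member of `L` satisfies `p`, then cut `L` at the first and at the last such member. -/
theorem List.exists_append_of_exists_mem {α : Type*} (p : α → Prop) (L : List α)
    (h : ∃ e ∈ L, p e) :
    ∃ (P : List α) (e : α) (M S : List α), L = P ++ e :: (M ++ S) ∧ p e ∧ (∀ f ∈ P, ¬p f) ∧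
      (∀ f ∈ S, ¬p f) ∧ (M = [] ∨ ∃ M' f, M = M' ++ [f] ∧ p f) := by
  have hlast : ∀ L : List α, ∃ M S : List α, L = M ++ S ∧ (∀ f ∈ S, ¬p f) ∧
      (M = [] ∨ ∃ M' f, M = M' ++ [f] ∧ p f) := by
    intro L
    induction L using List.reverseRecOn with
    | nil => exact ⟨[], [], rfl, by simp, Or.inl rfl⟩
    | append_singleton L f ih =>
      by_cases hf : p f
      · exact ⟨L ++ [f], [], by simp, by simp, Or.inr ⟨L, f, rfl, hf⟩⟩
      · obtain ⟨M, S, rfl, hS, hM⟩ := ih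
        refine ⟨M, S ++ [f], by simp, ?_, hM⟩
        exact List.forall_mem_append.mpr ⟨hS, by simpa using hf⟩
  induction L with
  | nil => simp at h
  | cons g L ih =>
    by_cases hg : p g
    · obtain ⟨M, S, rfl, hS, hM⟩ := hlast L
      exact ⟨[], g, M, S, rfl, hg, by simp, hS, hM⟩
    · obtain ⟨P, e, M, S, rfl, he, hP, hS, hM⟩ := ih (by simpa [hg] using h)
      exact ⟨g :: P, e, M, S, rfl, he, by simpa [hg] using hP, hS, hM⟩

namespace ArcCurve

variable {E : Type u} [MetricSpace E]

/-- The path `L` has at least four edges, and its end points are closer than `ε * δ` times the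
number of its edges. -/
def IsShortcut (ε δ : ℝ) (L : List (ArcCurve E)) : Prop :=
  4 ≤ L.length ∧ ∃ x y, IsPath x y L ∧ dist x y < ε * δ * L.length

theorem sum_occupation_le {L : List (ArcCurve E)} {x : E} {r c : ℝ}
    (h : ∀ e ∈ L, e.occupation x r ≤ ENNReal.ofReal c) :
    (L.map fun e => e.occupation x r).sum ≤ ENNReal.ofReal (L.length * c) := by
  refine (List.sum_le_card_nsmul _ (ENNReal.ofReal c) (by simpa using h)).trans_eq ?_
  rw [List.length_map, nsmul_eq_mul, ENNReal.ofReal_mul (Nat.cast_nonneg' _), ENNReal.ofReal_natCast]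

theorem sum_occupation_eq_zero {L : List (ArcCurve E)} {x : E} {r : ℝ}
    (h : ∀ e ∈ L, ¬∃ t ∈ Icc 0 e.length, dist x (e.toFun t) ≤ r) :
    (L.map fun e => e.occupation x r).sum = 0 := by
  refine le_antisymm ((sum_occupation_le (c := 0) fun e he => ?_).trans_eq (by simp)) zero_le
  rw [occupation_eq_zero fun t ht => not_le.mp fun hle => h e he ⟨t, ht, hle⟩]
  exact zero_le

/-- A path of short geodesic edges without proper shortcuts spends little time in each ball. -/
theorem sum_occupation_le_of_no_shortcut {ε δ : ℝ} (hε : 0 < ε) (hε1 : ε ≤ 1) (hδ : 0 < δ)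
    {x y : E} {B : List (ArcCurve E)} (hp : IsPath x y B)
    (hB : ∀ e ∈ B, e.IsGeodesic ∧ e.length ≤ δ)
    (hmin : ∀ M, M <:+: B → M.length < B.length → ¬IsShortcut ε δ M) (z : E) {r : ℝ}
    (hr : 0 < r) :
    (B.map fun e => e.occupation z r).sum ≤ ENNReal.ofReal (16 / ε * r) := by
  by_cases hhit : ∃ e ∈ B, ∃ t ∈ Icc 0 e.length, dist z (e.toFun t) ≤ r
  swap
  · rw [sum_occupation_eq_zero fun e he ht => hhit ⟨e, he, ht⟩]
    exact zero_le
  -- `e` is the first edge that meets the ball, and `M` runs from the next edge through the last one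
  -- that meets it; `P` and `S` contribute nothing.
  obtain ⟨P, e, M, S, rfl, he, hP, hS, hM⟩ := List.exists_append_of_exists_mem _ B hhit
  obtain ⟨w, -, -, hp⟩ := isPath_append.mp hp
  obtain ⟨w', hpM, -⟩ := isPath_append.mp hp
  have hdist : ∀ f ∈ P ++ e :: (M ++ S), (∃ t ∈ Icc 0 f.length, dist z (f.toFun t) ≤ r) →
      dist z (f.toFun f.length) ≤ r + δ := by
    rintro f hf ⟨t, ht, htr⟩
    have h1 := (hB f hf).1 t ht f.length ⟨f.length_nonneg, le_rfl⟩
    rw [abs_sub_comm, abs_of_nonneg (by linarith [ht.2])] at h1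
    have := dist_triangle z (f.toFun t) (f.toFun f.length)
    linarith [(hB f hf).2, ht.1]
  have hcount : (M.length : ℝ) ≤ 3 + (2 * r + 2 * δ) / (ε * δ) := by
    have hq : 0 ≤ (2 * r + 2 * δ) / (ε * δ) := by positivity
    rcases hM with rfl | ⟨M', f, hMf, hf⟩
    · simp only [List.length_nil, Nat.cast_zero]
      linarith
    have hw' : f.toFun f.length = w' := by
      rw [hMf] at hpM
      obtain ⟨_, -, hlast⟩ := isPath_append.mp hpM
      exact (isPath_singleton.mp hlast).2
    -- `M` omits `e`, so it is a proper part of the path and minimality applies.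
    have hns := hmin M ⟨P ++ [e], S, by simp⟩ (by simp; omega)
    rcases lt_or_ge M.length 4 with h4 | h4
    · have : (M.length : ℝ) ≤ 3 := by exact_mod_cast Nat.lt_succ_iff.mp h4
      linarith
    · have hge : ε * δ * M.length ≤ dist (e.toFun e.length) w' :=
        not_lt.mp fun hlt => hns ⟨h4, _, _, hpM, hlt⟩
      have h1 := hdist e (by simp) he
      have h2 := hdist f (by simp [hMf]) hf
      rw [hw'] at h2
      have h3 := dist_triangle_left (e.toFun e.length) w' z
      have : (M.length : ℝ) ≤ (2 * r + 2 * δ) / (ε * δ) := by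
        rw [le_div_iff₀ (by positivity)]
        linarith
      linarith
  have hedge : ∀ f ∈ P ++ e :: (M ++ S), f.occupation z r ≤ ENNReal.ofReal (min (2 * r) δ) := by
    intro f hf
    rw [ENNReal.ofReal_min]
    exact le_min ((hB f hf).1.occupation_le z r)
      ((f.occupation_le_length z r).trans (ENNReal.ofReal_le_ofReal (hB f hf).2))
  have hsum := sum_occupation_le (L := e :: M) (x := z) (r := r) fun f hf => hedge f (by
    simp only [List.mem_cons, List.mem_append] at hf ⊢
    tauto)
  rw [← List.cons_append, List.map_append, List.map_append, List.sum_append, List.sum_append,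
    sum_occupation_eq_zero hP, sum_occupation_eq_zero hS, zero_add, add_zero]
  refine hsum.trans (ENNReal.ofReal_le_ofReal ?_)
  rw [List.length_cons]
  push_cast
  have hone : 1 ≤ 1 / ε := (one_le_div hε).mpr hε1
  have hm0 : 0 ≤ min (2 * r) δ := by positivity
  have hle : ((M.length : ℝ) + 1) * min (2 * r) δ
      ≤ 4 * min (2 * r) δ + (2 * r + 2 * δ) / (ε * δ) * min (2 * r) δ := by nlinarith
  -- Bounding the minimum by `δ` against `2 * r` and by `2 * r` against `2 * δ` treats small and
  -- large radii at once.
  have hq : (2 * r + 2 * δ) / (ε * δ) * min (2 * r) δ ≤ 8 / ε * r := by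
    rw [div_mul_eq_mul_div, div_mul_eq_mul_div, div_le_div_iff₀ (by positivity) hε]
    have h1 : min (2 * r) δ ≤ 2 * r := min_le_left _ _
    have h2 : min (2 * r) δ ≤ δ := min_le_right _ _
    have h3 : (2 * r + 2 * δ) * min (2 * r) δ ≤ 8 * r * δ := by nlinarith
    nlinarith
  have h8 : 4 * min (2 * r) δ ≤ 8 / ε * r := by
    have h1 : min (2 * r) δ ≤ 2 * r := min_le_left _ _
    have : 1 * r ≤ 1 / ε * r := by gcongr
    have h2 : 8 / ε * r = 8 * (1 / ε * r) := by ring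
    linarith
  have : 16 / ε * r = 8 / ε * r + 8 / ε * r := by ring
  linarith

/-! ### Splitting off loops by induction on the number of edges. -/

/-- A closed path of short geodesic edges decomposes into closed curves of bounded Morrey norm. -/
theorem exists_decomposition (hE : IsGeodesicSpace E) {ε δ : ℝ} (hε : 0 < ε) (hε1 : ε ≤ 1 / 8)
    (hδ : 0 < δ) (n : ℕ) {x : E} {L : List (ArcCurve E)} (hn : L.length = n)
    (hp : IsPath x x L) (hL : ∀ e ∈ L, e.IsGeodesic ∧ e.length ≤ δ) :
    ∃ G : List (ArcCurve E), G ≠ [] ∧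
      (∀ g ∈ G, (g.IsPiecewiseGeodesic ∧ g.IsClosedCurve) ∧
        g.morreyNorm ≤ ENNReal.ofReal (18 / ε)) ∧
      (G.map current).sum = (L.map current).sum ∧
      (G.map length).sum ≤ (L.map length).sum + 4 * ε * δ * n := by
  induction n using Nat.strong_induction_on generalizing L with
  | _ n ih =>
  have hone : 8 ≤ 1 / ε := by
    rw [le_div_iff₀ hε]
    linarith
  rcases lt_or_ge n 4 with h4 | h4
  · obtain ⟨γ, h0, h1, hpg, hlen, hcur, hocc⟩ := exists_curve_of_isPath (fun e he => (hL e he).1) hp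
    refine ⟨[γ], by simp, ?_, by simp [hcur], ?_⟩
    · simp only [List.mem_singleton, forall_eq]
      refine ⟨⟨hpg, h1.trans h0.symm⟩, morreyNorm_le fun z r hr => (hocc z r).trans ?_⟩
      refine (sum_occupation_le fun e he => (hL e he).1.occupation_le z r).trans
        (ENNReal.ofReal_le_ofReal ?_)
      have hn4 : (L.length : ℝ) ≤ 4 := by
        rw [hn]
        exact_mod_cast h4.le
      have h18 : 18 / ε = 18 * (1 / ε) := by ring
      rw [h18]
      nlinarith
    · have : 0 ≤ 4 * ε * δ * n := by positivity
      simpa [hlen] using this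
  · classical
    -- The whole closed path qualifies, its end points being at distance `0`.
    have hex : ∃ m, ∃ B, B <:+: L ∧ B.length = m ∧ IsShortcut ε δ B := by
      refine ⟨_, L, List.infix_rfl, rfl, hn ▸ h4, x, x, hp, ?_⟩
      have : (0 : ℝ) < L.length := by
        rw [hn]
        exact_mod_cast (by omega : 0 < n)
      rw [dist_self]
      positivity
    obtain ⟨B, ⟨A, C, rfl⟩, hm, hB4, y, z, hpB', hd⟩ := Nat.find_spec hex
    have hmin : ∀ M, M <:+: B → M.length < B.length → ¬IsShortcut ε δ M := fun M hM hlt hs =>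
      Nat.find_min hex (hm ▸ hlt) ⟨M, hM.trans ⟨A, C, rfl⟩, rfl, hs⟩
    obtain ⟨w', hpAB, hpC⟩ := isPath_append.mp hp
    obtain ⟨w, hpA, hpB⟩ := isPath_append.mp hpAB
    have hBne : B ≠ [] := by
      rintro rfl
      simp at hB4
    have hLA : ∀ e ∈ A, e.IsGeodesic ∧ e.length ≤ δ := fun e he => hL e (by simp [he])
    have hLB : ∀ e ∈ B, e.IsGeodesic ∧ e.length ≤ δ := fun e he => hL e (by simp [he])
    have hLC : ∀ e ∈ C, e.IsGeodesic ∧ e.length ≤ δ := fun e he => hL e (by simp [he])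
    obtain ⟨rfl, rfl⟩ : y = w ∧ z = w' := isPath_endpoints_unique hBne hpB' hpB
    obtain ⟨c, hc, hc0, hc1⟩ := hE y z
    have hcd : c.length = dist y z := by
      rw [← hc0, ← hc1, hc 0 ⟨le_rfl, c.length_nonneg⟩ c.length ⟨c.length_nonneg, le_rfl⟩,
        zero_sub, abs_neg, abs_of_nonneg c.length_nonneg]
    obtain ⟨D, hpD, hLD, hlenD, hsumD, hcurD⟩ :=
      IsGeodesicOn.exists_short_isPath hδ hc le_rfl c.length_nonneg le_rfl
    have hcurD' : (D.map current).sum = c.current := by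
      ext ω
      rw [hcurD, current_eq_integral]
    rw [hc0, hc1] at hpD
    rw [sub_zero] at hsumD hlenD
    simp only [List.length_append] at hn
    have hB4' : (4 : ℝ) ≤ B.length := by exact_mod_cast hB4
    -- Since `ε ≤ 1 / 8` and `4 ≤ |B|`, both `ε * |B|` and the rounding loss `1` are absorbed by
    -- `|B| / 2`. This is why shortcuts need at least four edges.
    have hgain : (D.length : ℝ) + B.length / 2 ≤ B.length := by
      have : (D.length : ℝ) * δ ≤ (ε * B.length + 1) * δ := by linarith
      have := le_of_mul_le_mul_right this hδ
      nlinarith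
    have hlt : D.length < B.length := by
      have : (D.length : ℝ) < B.length := by linarith
      exact_mod_cast this
    obtain ⟨G, -, hG, hGcur, hGlen⟩ := ih (A.length + D.length + C.length) (by omega)
      (L := A ++ D ++ C) (by simp only [List.length_append])
      (isPath_append.mpr ⟨z, isPath_append.mpr ⟨y, hpA, hpD⟩, hpC⟩)
      (List.forall_mem_append.mpr ⟨List.forall_mem_append.mpr ⟨hLA, hLD⟩, hLC⟩)
    have hpBc : IsPath y y (B ++ [c.reverse]) := by
      refine isPath_append.mpr ⟨z, hpB, isPath_singleton.mpr ?_⟩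
      simp [reverse, hc0, hc1]
    obtain ⟨γ, h0, h1, hpg, hlen, hcur, hocc⟩ := exists_curve_of_isPath
      (List.forall_mem_append.mpr ⟨fun e he => (hLB e he).1, by simpa using hc.reverse⟩) hpBc
    refine ⟨γ :: G, by simp, List.forall_mem_cons.mpr ⟨⟨⟨hpg, h1.trans h0.symm⟩, ?_⟩, hG⟩, ?_, ?_⟩
    · refine morreyNorm_le fun q r hr => (hocc q r).trans ?_
      rw [List.map_append, List.sum_append, List.map_singleton, List.sum_singleton]
      -- The minimal run accounts for `16 / ε` and the closing geodesic for `2 ≤ 2 / ε`.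
      refine (add_le_add (sum_occupation_le_of_no_shortcut hε (by linarith) hδ hpB hLB hmin q hr)
        (hc.reverse.occupation_le q r)).trans ?_
      rw [← ENNReal.ofReal_add (by positivity) (by positivity)]
      refine ENNReal.ofReal_le_ofReal ?_
      have h18 : 18 / ε * r = 16 / ε * r + 2 * (1 / ε * r) := by ring
      nlinarith
    · simp only [List.map_cons, List.sum_cons, hcur, hGcur, List.map_append, List.sum_append,
        List.map_nil, List.sum_nil, current_reverse, hcurD']
      abel
    · have hrev : c.reverse.length = c.length := rfl
      simp only [List.map_cons, List.sum_cons, hlen, List.map_append, List.sum_append,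
        List.map_nil, List.sum_nil, hrev, hsumD, hcd] at hGlen ⊢
      rw [← hn]
      push_cast at hGlen ⊢
      have hεδ : 0 < ε * δ := mul_pos hε hδ
      -- The closing geodesic is counted twice, in the loop and in the shortened path; the budget `4
      -- * ε * δ` of the at least `|B| / 2` lost edges covers both.
      nlinarith [mul_le_mul_of_nonneg_left hgain hεδ.le]

end ArcCurve

/-! ### Choice of the constants. -/

theorem corollary3p2 :
    ∃ C : ℝ, 0 < C ∧
      ∀ (E : Type u) [MetricSpace E] [CompleteSpace E] [TopologicalSpace.SeparableSpace E],
        IsGeodesicSpace E →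
        ∀ η : ℝ, 0 < η → η < 1 →
        ∀ γ : ArcCurve E, γ.IsPiecewiseGeodesic → γ.IsClosedCurve →
          ∃ (N : ℕ) (g : Fin N → ArcCurve E), 0 < N ∧
            (∀ j, (g j).IsPiecewiseGeodesic ∧ (g j).IsClosedCurve) ∧
            γ.current = ∑ j, (g j).current ∧
            ∑ j, (g j).length ≤ (1 + η) * γ.length ∧
            ∀ j, (g j).morreyNorm ≤ ENNReal.ofReal (C / η ^ 2) := by
  -- `144 = 18 * 8`, from the Morrey bound `18 / ε` with `ε = η / 8`. This gives `144 / η`, which is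
  -- at most `144 / η ^ 2` because `η < 1`.
  refine ⟨144, by norm_num, ?_⟩
  intro E _ _ _ hE η hη hη1 γ ⟨k, s, hs, h0, hk, hgeo⟩ hclosed
  -- With `k * δ ≤ ℓ(γ)`, the rounding losses of the `k` pieces at most double the length, so the
  -- number of edges times `δ` is at most `2 * ℓ(γ)`.
  obtain ⟨δ, hδ, hkδ⟩ : ∃ δ > 0, k * δ ≤ γ.length := by
    rcases Nat.eq_zero_or_pos k with rfl | hk0
    · exact ⟨1, one_pos, by simpa using γ.length_nonneg⟩
    · have hpos : 0 < γ.length := by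
        rw [← hk, ← h0]
        exact hs (Fin.lt_def.mpr hk0)
      have hk' : (0 : ℝ) < k := by exact_mod_cast hk0
      exact ⟨γ.length / k, by positivity, (mul_div_cancel₀ _ hk'.ne').le⟩
  obtain ⟨L, hp, hL, hlen, hsum, hcur⟩ :=
    ArcCurve.exists_short_isPath hδ hs h0 hk hgeo (Fin.last k)
  rw [hk] at hp hlen hsum
  simp only [hk] at hcur
  rw [hclosed] at hp
  obtain ⟨G, hne, hG, hGcur, hGlen⟩ := ArcCurve.exists_decomposition hE (ε := η / 8)
    (by positivity) (by linarith) hδ L.length rfl hp hL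
  refine ⟨G.length, G.get, List.length_pos_of_ne_nil hne, fun j => (hG _ (G.get_mem j)).1, ?_, ?_,
    fun j => (hG _ (G.get_mem j)).2.trans (ENNReal.ofReal_le_ofReal ?_)⟩
  · have hGsum : ∑ j, (G.get j).current = (G.map ArcCurve.current).sum := by
      rw [← List.sum_ofFn, ← List.ofFn_get (G.map _)]
      simp
    rw [hGsum, hGcur]
    ext ω
    rw [hcur, ArcCurve.current_eq_integral]
  · have hGsum : ∑ j, (G.get j).length = (G.map ArcCurve.length).sum := by
      simp
    rw [hGsum]
    rw [Fin.val_last] at hlen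
    nlinarith
  · rw [div_le_div_iff₀ (by positivity) (by positivity)]
    nlinarith [mul_pos hη hη]
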